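/- Let $1\le p<2$ and let $\{X_{n,i}:1\le i\le n,\ n\ge 1\}$ be a triangular array of integrable mean-zero real random variables on a probability space $(\Omega,\mathcal F,\mathbb P)$. For $a>0$ let $$X_{n,i}^{(a)}=-a\,\mathbf 1(X_{n,i}<-a)+X_{n,i}\mathbf 1(|X_{n,i}|\le a)+a\,\mathbf 1(X_{n,i}>a).$$ Assume that the rows satisfy condition $(H)$ with a common constant: there is a constant $C$, depending neither on the row $N$ nor on the level $a$, such that for all $N\ge 1$, all $a>0$ and all integers $m\ge 0$, $n\ge 1$ with $m+n\le N$, $$\mathbb E\Big(\max_{1\le k\le n}\Big|\sum_{i=m+1}^{m+k}\big(X_{N,i}^{(a)}-\mathbb E X_{N,i}^{(a)}\big)\Big|\Big)^2\le C\sum_{i=m+1}^{m+n}\mathbb E\big(X_{N,i}^{(a)}\big)^2 .$$ Let $$G(x)=\sup_{n\ge 1}\frac1n\sum_{i=1}^n\mathbb P(|X_{n,i}|>x),\qquad x\in\mathbb R.$$ Let $L$ be a real-valued slowly varying function, i.e. $L$ is positive and measurable on $[A,\infty)$ for some $A\ge 0$, and $\lim_{x\to\infty}L(\lambda x)/L(x)=1$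 for each $\lambda>0$. When $p=1$, assume further that $L$ is nondecreasing on $[0,\infty)$ and $L(x)\ge 1$ for all $x\ge 0$. Let $\tilde L$ be a de Bruijn conjugate of $L$, i.e. a slowly varying function (unique up to asymptotic equivalence) with $$\lim_{x\to\infty}L(x)\,\tilde L(xL(x))=1\quad\text{and}\quad\lim_{x\to\infty}\tilde L(x)\,L(x\tilde L(x))=1 .$$ If $$\int_0^\infty x^{p-1}L^p(x)\,G(x)\,dx<\infty,$$ then $$\sum_{n=1}^\infty n^{-1}\,\mathbb P\Big(\max_{1\le k\le n}\Big|\sum_{i=1}^k X_{n,i}\Big|>\varepsilon\, n^{1/p}\tilde L(n^{1/p})\Big)<\infty\quad\text{for all }\varepsilon>0 .$$ -/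

import Mathlib

open MeasureTheory Filter Topology

noncomputable section

/-- `L` is slowly varying at infinity: for some `A ≥ 0` it is positive and (Lebesgue) measurable
on `[A, ∞)`, and `L (c * x) / L x → 1` as `x → ∞` for each `c > 0`. The values of `L` to the left
of `A` are unrestricted. -/
structure SlowlyVarying (L : ℝ → ℝ) : Prop where
  pos_measurable : ∃ A : ℝ, 0 ≤ A ∧ (∀ x, A ≤ x → 0 < L x) ∧
    AEMeasurable L (volume.restrict (Set.Ici A))
  tendsto_ratio : ∀ c : ℝ, 0 < c → Tendsto (fun x => L (c * x) / L x) atTop (𝓝 1)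

/-- `M` is a de Bruijn conjugate of `L` (it is unique up to asymptotic equivalence). -/
structure IsDeBruijnConjugate (L M : ℝ → ℝ) : Prop where
  slowlyVarying : SlowlyVarying M
  left : Tendsto (fun x => L x * M (x * L x)) atTop (𝓝 1)
  right : Tendsto (fun x => M x * L (x * M x)) atTop (𝓝 1)

/-- `max_{1 ≤ k ≤ n} |y_{m+1} + ⋯ + y_{m+k}|`. -/
def maxPartialSum (y : ℕ → ℝ) (m n : ℕ) : ℝ :=
  ⨆ k : Set.Icc 1 n, |∑ i ∈ Finset.Ioc m (m + k), y i|

/-- Truncation at level `a > 0`: it is `-a` if `x < -a`, `x` if `|x| ≤ a`, and `a` if `x > a`. -/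
def trunc (a x : ℝ) : ℝ := max (-a) (min x a)

/-- Condition `(H)` with constant `C` for the finite collection `Z 1, …, Z N`. The constant does not
depend on the truncation level `a`. -/
def ConditionH {Ω : Type*} [MeasurableSpace Ω] (μ : Measure Ω) (Z : ℕ → Ω → ℝ) (N : ℕ)
    (C : ℝ) : Prop :=
  ∀ a : ℝ, 0 < a → ∀ m n : ℕ, 1 ≤ n → m + n ≤ N →
    ∫ ω, (maxPartialSum (fun i => trunc a (Z i ω) - ∫ ω', trunc a (Z i ω') ∂μ) m n) ^ 2 ∂μ ≤
      C * ∑ i ∈ Finset.Ioc m (m + n), ∫ ω, (trunc a (Z i ω)) ^ 2 ∂μ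

/-- `G(x) = sup_{n ≥ 1} n⁻¹ ∑_{i=1}^n P(|X_{n,i}| > x)`; the supremum is over a family bounded
by `1` when `μ` is a probability measure. -/
def averagedTail {Ω : Type*} [MeasurableSpace Ω] (μ : Measure Ω) (X : ℕ → ℕ → Ω → ℝ)
    (x : ℝ) : ℝ :=
  ⨆ n : ℕ+, ((n : ℕ) : ℝ)⁻¹ * ∑ i ∈ Finset.Icc 1 (n : ℕ), μ.real {ω | x < |X n i ω|}

end

/-! Write `b n = n^(1/p) M(n^(1/p))`. Conjugacy makes `b n * L (b n)` comparable to `n^(1/p)`, so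
`n` is comparable to `(b n * L (b n))^p`. Truncate row `n` at level `b n`.

Since the variables are centred, the truncated means sum in absolute value to at most `n ∫_{b n}^∞
G`. The weight `x^(p-1) L(x)^p` is almost increasing, so this is at most a constant times `b n`
times a tail of the convergent integral, and eventually at most `ε b n / 2`. Condition (H) and
Chebyshev's inequality then bound the `n`-th probability by `n G(b n)` plus a constant times `n (b
n)⁻² ∫_0^{b n} 2x G(x) dx`; monotonicity of `G` absorbs the first term into the second
(`ConditionH.measure_lt_maxPartialSum_le`, `mul_le_setLIntegral_of_antitone`).

After division by `n`, sum and integral are interchanged (`tsum_mul_setLIntegral_lt_top`). Potter's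
bound gives `∑_{b n ≥ x} (b n)⁻² ≤ D x^(p-2) L(x)^p` for large `x` (`SlowlyVarying.tsum_inv_sq_le`);
multiplied by `2x G(x)`, this is the integrand of the hypothesis. -/

/-! ### Slow variation: uniform convergence and Potter's bound -/

theorem SlowlyVarying.eventually_pos {L : ℝ → ℝ} (hL : SlowlyVarying L) :
    ∀ᶠ x in atTop, 0 < L x := by
  obtain ⟨A, -, hA, -⟩ := hL.pos_measurable
  filter_upwards [eventually_ge_atTop A] with x hx using hA x hx

theorem SlowlyVarying.tendsto_log_sub {L : ℝ → ℝ} (hL : SlowlyVarying L) {c : ℝ} (hc : 0 < c) :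
    Tendsto (fun x => Real.log (L (c * x)) - Real.log (L x)) atTop (𝓝 0) := by
  have h := (Real.continuousAt_log (one_ne_zero)).tendsto.comp (hL.tendsto_ratio c hc)
  rw [Real.log_one] at h
  refine h.congr' ?_
  have h2 : ∀ᶠ x in atTop, 0 < L (c * x) :=
    (tendsto_id.const_mul_atTop hc).eventually hL.eventually_pos
  filter_upwards [hL.eventually_pos, h2] with x h1 h2
  simp [Real.log_div h2.ne' h1.ne']

theorem SlowlyVarying.eventually_aemeasurable_log_sub {L : ℝ → ℝ} (hL : SlowlyVarying L) :
    ∀ᶠ x in atTop, AEMeasurable (fun y =>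
      ENNReal.ofReal (min |Real.log (L (y * x)) - Real.log (L x)| 1))
      (volume.restrict (Set.Icc (1 : ℝ) 4)) := by
  obtain ⟨A, hA0, hA, hm⟩ := hL.pos_measurable
  filter_upwards [eventually_ge_atTop A, eventually_gt_atTop 0] with x hxA hx0
  have hq : Measure.QuasiMeasurePreserving (fun y : ℝ => y * x)
      (volume.restrict (Set.Icc (1 : ℝ) 4)) (volume.restrict (Set.Ici A)) := by
    have h0 : Measure.QuasiMeasurePreserving (fun y : ℝ => y * x) volume volume := by
      refine ⟨measurable_id.mul_const x, ?_⟩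
      rw [Real.map_volume_mul_right hx0.ne']
      exact Measure.smul_absolutelyContinuous
    refine h0.restrict fun y hy => ?_
    simp only [Set.mem_Ici]
    nlinarith [hy.1]
  have := hm.comp_quasiMeasurePreserving hq
  exact ((((Real.measurable_log.comp_aemeasurable this).sub_const _).abs).min
    aemeasurable_const).ennreal_ofReal

/-- Dominated convergence; the cutoff at 1 supplies the dominating function. -/
theorem SlowlyVarying.tendsto_lintegral_log_sub {L : ℝ → ℝ} (hL : SlowlyVarying L) :
    Tendsto (fun x => ∫⁻ y in Set.Icc (1 : ℝ) 4,
      ENNReal.ofReal (min |Real.log (L (y * x)) - Real.log (L x)| 1)) atTop (𝓝 0) := by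
  obtain ⟨A, hA⟩ := eventually_atTop.1 hL.eventually_aemeasurable_log_sub
  refine tendsto_of_seq_tendsto fun u hu => ?_
  -- Measurability is only available from `A` on, so the sequence is replaced by `max A (u n)`,
  -- which eventually agrees with it.
  have key := tendsto_lintegral_of_dominated_convergence'
    (μ := volume.restrict (Set.Icc (1 : ℝ) 4))
    (F := fun (n : ℕ) y => ENNReal.ofReal
      (min |Real.log (L (y * max A (u n))) - Real.log (L (max A (u n)))| 1))
    (f := fun _ => 0) (fun _ => 1) (fun n => hA _ (le_max_left _ _))
    (fun n => Eventually.of_forall fun y => by simp) (by simp) ?_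
  · simp only [lintegral_zero] at key
    refine key.congr' ?_
    filter_upwards [hu.eventually_ge_atTop (A)] with n hn
    simp only [max_eq_right hn, Function.comp_def]
  · filter_upwards [ae_restrict_mem measurableSet_Icc] with y hy
    have h := (hL.tendsto_log_sub (c := y) (by linarith [hy.1])).abs
    have h2 := h.min (tendsto_const_nhds (x := (1 : ℝ)))
    have h3 := (ENNReal.tendsto_ofReal h2).comp
      (tendsto_atTop_mono (fun n => le_max_right (A) (u n)) hu)
    simpa [Function.comp_def] using h3

open scoped Pointwise in
/-- The uniform convergence theorem, on `[1, 2]`. -/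
theorem SlowlyVarying.uniform {L : ℝ → ℝ} (hL : SlowlyVarying L) {δ : ℝ} (hδ : 0 < δ) :
    ∃ X : ℝ, 0 < X ∧ ∀ x, X ≤ x → 0 < L x ∧
      ∀ u, 1 ≤ u → u ≤ 2 → |Real.log (L (u * x)) - Real.log (L x)| ≤ δ := by
  set t : ENNReal := ENNReal.ofReal (min (δ / 2) 1) with ht
  have ht0 : 0 < t := by rw [ht]; simp [hδ]
  have htop : t ≠ ⊤ := ENNReal.ofReal_ne_top
  let bad : ℝ → Set ℝ := fun x =>
    {y | t ≤ ENNReal.ofReal (min |Real.log (L (y * x)) - Real.log (L x)| 1)} ∩ Set.Icc 1 4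
  have hbad : ∀ᶠ x in atTop, volume (bad x) < 1 / 2 := by
    have hlim := hL.tendsto_lintegral_log_sub.eventually_lt_const
      (u := t / 2) (ENNReal.div_pos ht0.ne' (by simp))
    filter_upwards [hlim, hL.eventually_aemeasurable_log_sub] with x hx hxm
    have h1 := meas_ge_le_lintegral_div hxm ht0.ne' htop
    rw [Measure.restrict_apply' measurableSet_Icc] at h1
    refine h1.trans_lt ?_
    rw [ENNReal.div_lt_iff (Or.inl ht0.ne') (Or.inl htop), one_div, mul_comm,
      ← div_eq_mul_inv]
    exact hx
  have hgood : ∀ x y, 1 ≤ y → y ≤ 4 → y ∉ bad x →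
      |Real.log (L (y * x)) - Real.log (L x)| < δ / 2 := by
    intro x y h1 h4 hy
    by_contra! hcon
    exact hy ⟨ENNReal.ofReal_le_ofReal (min_le_min_right 1 hcon), h1, h4⟩
  obtain ⟨X, hX⟩ := eventually_atTop.1 (hbad.and hL.eventually_pos)
  refine ⟨max X 1, by positivity, fun x hx => ?_⟩
  have hxX : X ≤ x := (le_max_left _ _).trans hx
  have hx1 : 1 ≤ x := (le_max_right _ _).trans hx
  refine ⟨(hX x hxX).2, fun u hu1 hu2 => ?_⟩
  have hux : X ≤ u * x := by nlinarith
  have hu0 : 0 < u := by linarith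
  -- The two bad sets have total measure at most 1/2 + 2 · 1/2 = 3/2, less than the length 2 of `[2,
  -- 4]`. For a good `y`, both `L x` and `L (u * x)` are close to `L (y * x)`, and `y / u` stays in
  -- `[1, 4]`.
  obtain ⟨y, hy, hyn⟩ : ∃ y ∈ Set.Icc (2 : ℝ) 4, y ∉ bad x ∪ u • bad (u * x) := by
    by_contra! hcon
    have h1 : volume (Set.Icc (2 : ℝ) 4) ≤ volume (bad x) + volume (u • bad (u * x)) :=
      (measure_mono hcon).trans (measure_union_le _ _)
    rw [Measure.addHaar_smul, Real.volume_Icc] at h1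
    have h2 : ENNReal.ofReal |u ^ Module.finrank ℝ ℝ| * volume (bad (u * x)) ≤ 2 * (1 / 2) := by
      refine mul_le_mul' ?_ (hX _ hux).1.le
      rw [ENNReal.ofReal_le_iff_le_toReal (by simp)]
      simp [abs_of_pos hu0, hu2]
    have h3 := h1.trans (add_le_add (hX x hxX).1.le h2)
    have h4 : (1 / 2 + 2 * (1 / 2) : ENNReal) = ENNReal.ofReal (3 / 2) := by
      rw [← ENNReal.toReal_eq_toReal_iff' (by finiteness) (by finiteness)]
      rw [ENNReal.toReal_add (by finiteness) (by finiteness)]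
      norm_num
    rw [h4, ENNReal.ofReal_le_ofReal_iff (by norm_num)] at h3
    norm_num at h3
  rw [Set.mem_union, not_or] at hyn
  have g1 := hgood x y (by linarith [hy.1]) hy.2 hyn.1
  have g2 := hgood (u * x) (y / u) (by rw [le_div_iff₀ hu0]; linarith [hy.1])
    (by rw [div_le_iff₀ hu0]; nlinarith [hy.2]) (fun hmem => hyn.2 ⟨_, hmem, by
      simp [smul_eq_mul]; field_simp⟩)
  rw [show y / u * (u * x) = y * x by field_simp] at g2
  rw [abs_lt] at g1 g2
  rw [abs_le]
  constructor <;> linarith [g1.1, g1.2, g2.1, g2.2]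

/-- Potter's bound for slowly varying functions. -/
theorem SlowlyVarying.potter {L : ℝ → ℝ} (hL : SlowlyVarying L) {η : ℝ} (hη : 0 < η) :
    ∃ X : ℝ, 0 < X ∧ ∀ x, X ≤ x → 0 < L x ∧ ∀ y, x ≤ y →
      L y ≤ (2 * (y / x)) ^ η * L x ∧ L x ≤ (2 * (y / x)) ^ η * L y := by
  have hlog2 : 0 < Real.log 2 := Real.log_pos one_lt_two
  obtain ⟨X, hX0, hX⟩ := hL.uniform (δ := η * Real.log 2) (by positivity)
  have hind : ∀ n : ℕ, ∀ x, X ≤ x → ∀ y, x ≤ y → y ≤ 2 ^ n * x →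
      |Real.log (L y) - Real.log (L x)| ≤ n * (η * Real.log 2) := by
    intro n
    induction n with
    | zero =>
      intro x hx y hxy hy
      have : y = x := by apply le_antisymm _ hxy; simpa using hy
      simp [this]
    | succ n ih =>
      intro x hx y hxy hy
      have hx0 : 0 < x := hX0.trans_le hx
      push_cast
      rcases le_or_gt y (2 * x) with h | h
      · have h1 := (hX x hx).2 (y / x) ((one_le_div hx0).2 hxy) ((div_le_iff₀ hx0).2 h)
        rw [div_mul_cancel₀ _ hx0.ne'] at h1
        have : 0 ≤ (n : ℝ) * (η * Real.log 2) := by positivity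
        linarith
      · have h1 := (hX x hx).2 2 (by norm_num) le_rfl
        have h2 := ih (2 * x) (by linarith) y h.le (by rw [pow_succ] at hy; linarith)
        have h3 := abs_sub_le (Real.log (L y)) (Real.log (L (2 * x))) (Real.log (L x))
        linarith
  refine ⟨X, hX0, fun x hx => ⟨(hX x hx).1, fun y hxy => ?_⟩⟩
  have hx0 : 0 < x := hX0.trans_le hx
  have hy0 : 0 < y := hx0.trans_le hxy
  have hLx := (hX x hx).1
  have hLy := (hX y (hx.trans hxy)).1
  have hr1 : 1 ≤ y / x := (one_le_div hx0).2 hxy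
  have hr0 : 0 < y / x := by positivity
  have hrl : 0 ≤ Real.log (y / x) := Real.log_nonneg hr1
  -- `y` is reached from `x` in `⌈log₂ (y / x)⌉` doublings; rounding up costs the factor 2 inside
  -- the power.
  have hb : |Real.log (L y) - Real.log (L x)| ≤ η * Real.log (2 * (y / x)) := by
    have hn := Nat.le_ceil (Real.log (y / x) / Real.log 2)
    have hn2 := Nat.ceil_lt_add_one (a := Real.log (y / x) / Real.log 2) (by positivity)
    set n := ⌈Real.log (y / x) / Real.log 2⌉₊
    have h1 := hind n x hx y hxy (by
      rw [div_le_iff₀ hlog2] at hn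
      rw [← div_le_iff₀ hx0, ← Real.log_le_log_iff hr0 (by positivity), Real.log_pow]
      exact hn)
    refine h1.trans ?_
    rw [Real.log_mul two_ne_zero hr0.ne']
    have : n * Real.log 2 ≤ Real.log (y / x) + Real.log 2 := by
      have h3 := mul_le_mul_of_nonneg_right hn2.le hlog2.le
      rw [add_mul, div_mul_cancel₀ _ hlog2.ne'] at h3
      linarith
    nlinarith
  rw [abs_le] at hb
  have hpos : (0 : ℝ) < (2 * (y / x)) ^ η := by positivity
  constructor
  · rw [← Real.log_le_log_iff hLy (by positivity), Real.log_mul hpos.ne' hLx.ne',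
      Real.log_rpow (by positivity)]
    linarith [hb.2]
  · rw [← Real.log_le_log_iff hLx (by positivity), Real.log_mul hpos.ne' hLy.ne',
      Real.log_rpow (by positivity)]
    linarith [hb.1]

/-! ### Truncation and maximal partial sums -/

theorem abs_trunc {a : ℝ} (ha : 0 < a) (x : ℝ) : |trunc a x| = min |x| a := by
  unfold trunc
  rcases le_total x a with h | h
  · rcases le_total (-a) x with h' | h'
    · rw [min_eq_left h, max_eq_right h', min_eq_left (abs_le.2 ⟨h', h⟩)]
    · rw [min_eq_left h, max_eq_left h', abs_neg, abs_of_pos ha, min_eq_right]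
      exact le_abs.2 (Or.inr (by linarith))
  · rw [min_eq_right h, max_eq_right (by linarith), abs_of_pos ha, min_eq_right]
    exact h.trans (le_abs_self x)

theorem trunc_eq_self {a x : ℝ} (h : |x| ≤ a) : trunc a x = x := by
  rw [abs_le] at h
  unfold trunc
  rw [min_eq_left h.2, max_eq_right h.1]

theorem abs_sub_trunc {a : ℝ} (ha : 0 < a) (x : ℝ) : |x - trunc a x| = max (|x| - a) 0 := by
  unfold trunc
  rcases le_total x a with h | h
  · rcases le_total (-a) x with h' | h'
    · rw [min_eq_left h, max_eq_right h', sub_self, abs_zero, max_eq_right]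
      linarith [abs_le.2 ⟨h', h⟩]
    · rw [min_eq_left h, max_eq_left h', abs_of_nonpos (by linarith : x ≤ 0),
        abs_of_nonpos (by linarith), max_eq_left (by linarith)]
      ring
  · rw [min_eq_right h, max_eq_right (by linarith), abs_of_nonneg (by linarith : 0 ≤ x),
      abs_of_nonneg (by linarith), max_eq_left (by linarith)]

theorem continuous_trunc (a : ℝ) : Continuous (trunc a) := by
  unfold trunc
  fun_prop

theorem abs_sum_le_maxPartialSum (y : ℕ → ℝ) (m : ℕ) {n k : ℕ} (hk : k ∈ Set.Icc 1 n) :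
    |∑ i ∈ Finset.Ioc m (m + k), y i| ≤ maxPartialSum y m n :=
  le_ciSup (f := fun k : Set.Icc 1 n => |∑ i ∈ Finset.Ioc m (m + k), y i|)
    (Set.finite_range _).bddAbove ⟨k, hk⟩

theorem maxPartialSum_le {y : ℕ → ℝ} {m n : ℕ} (hn : 1 ≤ n) {c : ℝ}
    (h : ∀ k ∈ Set.Icc 1 n, |∑ i ∈ Finset.Ioc m (m + k), y i| ≤ c) :
    maxPartialSum y m n ≤ c := by
  have : Nonempty (Set.Icc 1 n) := ⟨⟨1, le_rfl, hn⟩⟩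
  exact ciSup_le fun k => h k k.2

theorem maxPartialSum_nonneg (y : ℕ → ℝ) (m n : ℕ) : 0 ≤ maxPartialSum y m n :=
  Real.iSup_nonneg fun _ => abs_nonneg _

/-! ### Moments of truncated variables and the maximal tail bound -/

section Probability

variable {Ω : Type*} [MeasurableSpace Ω] {μ : Measure Ω}

/-- Layer-cake formula: the tail of `min |f| a` is that of `f` below `a` and vanishes beyond. -/
theorem lintegral_trunc_sq_le {f : Ω → ℝ} (hf : AEMeasurable f μ) {a : ℝ} (ha : 0 < a) :
    ∫⁻ ω, ENNReal.ofReal ((trunc a (f ω)) ^ 2) ∂μ ≤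
      ∫⁻ t in Set.Ioc 0 a, μ {ω | t < |f ω|} * ENNReal.ofReal (2 * t) := by
  have hm : AEMeasurable (fun ω => |trunc a (f ω)|) μ :=
    ((continuous_trunc a).measurable.comp_aemeasurable hf).abs
  have h := lintegral_rpow_eq_lintegral_meas_lt_mul μ
    (Eventually.of_forall fun ω => abs_nonneg (trunc a (f ω))) hm (p := 2) two_pos
  simp only [Real.rpow_two, sq_abs] at h
  rw [h, ← lintegral_const_mul' _ _ ENNReal.ofReal_ne_top,
    ← lintegral_indicator measurableSet_Ioi, ← lintegral_indicator measurableSet_Ioc]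
  refine lintegral_mono fun t => ?_
  by_cases ht : t ∈ Set.Ioc 0 a
  · rw [Set.indicator_of_mem (show t ∈ Set.Ioi 0 from ht.1), Set.indicator_of_mem ht,
      ENNReal.ofReal_mul two_pos.le, mul_left_comm]
    norm_num only [Real.rpow_one]
    refine mul_le_mul' (measure_mono fun ω (hω : t < |trunc a (f ω)|) => ?_) le_rfl
    rw [abs_trunc ha] at hω
    exact hω.trans_le (min_le_left _ _)
  · rw [Set.indicator_of_notMem ht]
    by_cases h0 : 0 < t
    · have hat : a < t := by
        by_contra! hcon
        exact ht ⟨h0, hcon⟩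
      rw [Set.indicator_of_mem (show t ∈ Set.Ioi 0 from h0)]
      have : {ω | t < |trunc a (f ω)|} = ∅ := by
        ext ω
        simp only [abs_trunc ha, Set.mem_ofPred_eq, Set.mem_empty_iff_false, iff_false, not_lt]
        exact (min_le_right _ _).trans hat.le
      simp [this]
    · rw [Set.indicator_of_notMem (show t ∉ Set.Ioi 0 from h0)]

/-- As `f` is centred, its truncated mean is minus the mean of `f - trunc a f`, whose modulus is
`(|f| - a)⁺`; the layer-cake formula is then shifted by `a`. -/
theorem abs_integral_trunc_le [IsFiniteMeasure μ] {f : Ω → ℝ} (hf : Integrable f μ)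
    (h0 : ∫ ω, f ω ∂μ = 0) {a : ℝ} (ha : 0 < a) :
    ENNReal.ofReal |∫ ω, trunc a (f ω) ∂μ| ≤ ∫⁻ t in Set.Ioi a, μ {ω | t < |f ω|} := by
  have hm : AEStronglyMeasurable (fun ω => trunc a (f ω)) μ :=
    (continuous_trunc a).comp_aestronglyMeasurable hf.1
  have ht : Integrable (fun ω => trunc a (f ω)) μ := hf.mono hm (Eventually.of_forall fun ω => by
    rw [Real.norm_eq_abs, Real.norm_eq_abs, abs_trunc ha]; exact min_le_left _ _)
  have hd : Integrable (fun ω => f ω - trunc a (f ω)) μ := hf.sub ht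
  have h1 : |∫ ω, trunc a (f ω) ∂μ| ≤ ∫ ω, |f ω - trunc a (f ω)| ∂μ := by
    have : ∫ ω, (f ω - trunc a (f ω)) ∂μ = - ∫ ω, trunc a (f ω) ∂μ := by
      rw [integral_sub hf ht, h0, zero_sub]
    rw [← abs_neg, ← this]
    exact abs_integral_le_integral_abs
  refine (ENNReal.ofReal_le_ofReal h1).trans ?_
  rw [ofReal_integral_eq_lintegral_ofReal hd.abs (Eventually.of_forall fun ω => abs_nonneg _),
    lintegral_eq_lintegral_meas_lt μ (Eventually.of_forall fun ω => abs_nonneg _)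
      hd.abs.1.aemeasurable]
  have hmp := (measurePreserving_add_right (volume : Measure ℝ) a).setLIntegral_comp_preimage_emb
    (measurableEmbedding_addRight a) (fun t => μ {ω | t < |f ω|}) (Set.Ioi a)
  rw [← hmp]
  have : (fun x => x + a) ⁻¹' Set.Ioi a = Set.Ioi 0 := by ext; simp
  rw [this]
  refine setLIntegral_mono' measurableSet_Ioi fun t ht0 => measure_mono fun ω hω => ?_
  simp only [Set.mem_ofPred_eq, abs_sub_trunc ha, lt_max_iff] at hω ⊢
  rcases hω with h | h
  · linarith
  · exact absurd h (not_lt.2 (le_of_lt ht0))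

theorem aemeasurable_maxPartialSum {Y : ℕ → Ω → ℝ} {m n : ℕ}
    (hY : ∀ i ∈ Finset.Ioc m (m + n), AEMeasurable (Y i) μ) :
    AEMeasurable (fun ω => maxPartialSum (fun i => Y i ω) m n) μ := by
  unfold maxPartialSum
  refine AEMeasurable.iSup fun k => ?_
  refine AEMeasurable.abs ?_
  refine Finset.aemeasurable_fun_sum _ fun i hi => hY i ?_
  rw [Finset.mem_Ioc] at hi ⊢
  have := k.2.2
  omega

/-- Tail bound for the maximal partial sum of a finite family satisfying `ConditionH`. -/
theorem ConditionH.measure_lt_maxPartialSum_le [IsProbabilityMeasure μ] {Z : ℕ → Ω → ℝ} {n : ℕ}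
    {C : ℝ} (hn : 1 ≤ n) (hH : ConditionH μ Z n C) (hC : 0 ≤ C)
    (hint : ∀ i, 1 ≤ i → i ≤ n → Integrable (Z i) μ)
    (hmean : ∀ i, 1 ≤ i → i ≤ n → ∫ ω, Z i ω ∂μ = 0)
    {g : ℝ → ENNReal} (hg : ∀ x, ∑ i ∈ Finset.Ioc 0 n, μ {ω | x < |Z i ω|} ≤ n * g x)
    (hgm : Measurable g)
    {a ε : ℝ} (ha : 0 < a) (hε : 0 < ε)
    (hsmall : n * ∫⁻ x in Set.Ioi a, g x ≤ ENNReal.ofReal (ε * a / 2)) :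
    μ {ω | ε * a < maxPartialSum (fun i => Z i ω) 0 n} ≤
      n * g a + ENNReal.ofReal (C / (ε * a / 2) ^ 2) *
        (n * ∫⁻ x in Set.Ioc 0 a, g x * ENNReal.ofReal (2 * x)) := by
  have hI : ∀ i ∈ Finset.Ioc 0 n, Integrable (Z i) μ ∧ ∫ ω, Z i ω ∂μ = 0 := by
    intro i hi
    rw [Finset.mem_Ioc] at hi
    exact ⟨hint i hi.1 hi.2, hmean i hi.1 hi.2⟩
  have hanti : ∀ i, Antitone fun x : ℝ => μ {ω | x < |Z i ω|} := fun i x y hxy =>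
    measure_mono fun ω (hω : y < _) => lt_of_le_of_lt hxy hω
  set c : ℕ → ℝ := fun i => ∫ ω, trunc a (Z i ω) ∂μ with hc
  set W : Ω → ℝ := fun ω => maxPartialSum (fun i => trunc a (Z i ω) - c i) 0 n with hW
  have hcsum : ∑ i ∈ Finset.Ioc 0 n, |c i| ≤ ε * a / 2 := by
    rw [← ENNReal.ofReal_le_ofReal_iff (by positivity),
      ENNReal.ofReal_sum_of_nonneg fun i _ => abs_nonneg _]
    calc ∑ i ∈ Finset.Ioc 0 n, ENNReal.ofReal |c i|
        ≤ ∑ i ∈ Finset.Ioc 0 n, ∫⁻ t in Set.Ioi a, μ {ω | t < |Z i ω|} :=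
          Finset.sum_le_sum fun i hi => abs_integral_trunc_le (hI i hi).1 (hI i hi).2 ha
      _ = ∫⁻ t in Set.Ioi a, ∑ i ∈ Finset.Ioc 0 n, μ {ω | t < |Z i ω|} :=
          (lintegral_finsetSum _ fun i _ => (hanti i).measurable).symm
      _ ≤ ∫⁻ t in Set.Ioi a, n * g t := lintegral_mono fun t => hg t
      _ = n * ∫⁻ t in Set.Ioi a, g t := lintegral_const_mul _ hgm
      _ ≤ _ := hsmall
  -- If no variable exceeds `a`, truncation changes nothing, and the centring moves each partial sum
  -- by at most `ε * a / 2`; the centred maximum must supply the other half.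
  have hsub : {ω | ε * a < maxPartialSum (fun i => Z i ω) 0 n} ⊆
      (⋃ i ∈ Finset.Ioc 0 n, {ω | a < |Z i ω|}) ∪ {ω | (ε * a / 2) ^ 2 ≤ W ω ^ 2} := by
    intro ω hω
    by_contra hcon
    simp only [Set.mem_union, Set.mem_iUnion, Set.mem_ofPred_eq, not_or, not_exists, not_lt,
      not_le] at hcon hω
    obtain ⟨h1, h2⟩ := hcon
    have hWlt : W ω < ε * a / 2 := lt_of_pow_lt_pow_left₀ 2 (by positivity) h2
    have : maxPartialSum (fun i => Z i ω) 0 n ≤ W ω + ε * a / 2 := by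
      refine maxPartialSum_le hn fun k hk => ?_
      have hkn : Finset.Ioc 0 (0 + k) ⊆ Finset.Ioc 0 n := by
        rw [zero_add]
        exact Finset.Ioc_subset_Ioc_right hk.2
      have e : ∑ i ∈ Finset.Ioc 0 (0 + k), Z i ω =
          ∑ i ∈ Finset.Ioc 0 (0 + k), (trunc a (Z i ω) - c i) +
            ∑ i ∈ Finset.Ioc 0 (0 + k), c i := by
        rw [← Finset.sum_add_distrib]
        refine Finset.sum_congr rfl fun i hi => ?_
        rw [trunc_eq_self (h1 i (hkn hi)), sub_add_cancel]
      rw [e]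
      refine (abs_add_le _ _).trans (add_le_add ?_ ?_)
      · exact abs_sum_le_maxPartialSum (fun i => trunc a (Z i ω) - c i) 0 hk
      · refine (Finset.abs_sum_le_sum_abs _ _).trans (le_trans ?_ hcsum)
        exact Finset.sum_le_sum_of_subset_of_nonneg hkn fun _ _ _ => abs_nonneg _
    linarith
  have htm : ∀ i ∈ Finset.Ioc 0 n, AEMeasurable (fun ω => trunc a (Z i ω)) μ := fun i hi =>
    (continuous_trunc a).measurable.comp_aemeasurable (hI i hi).1.1.aemeasurable
  have htle : ∀ x, |trunc a x| ≤ a := fun x => by rw [abs_trunc ha]; exact min_le_right _ _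
  have hWm : AEMeasurable W μ := aemeasurable_maxPartialSum fun i hi =>
    (htm i (by simpa using hi)).sub_const _
  have hWint : Integrable (fun ω => W ω ^ 2) μ := by
    refine Integrable.of_bound (hWm.pow_const 2).aestronglyMeasurable
      ((∑ i ∈ Finset.Ioc 0 n, (a + |c i|)) ^ 2) (Eventually.of_forall fun ω => ?_)
    rw [norm_pow, Real.norm_eq_abs, abs_of_nonneg (maxPartialSum_nonneg _ _ _)]
    refine pow_le_pow_left₀ (maxPartialSum_nonneg _ _ _) (maxPartialSum_le hn fun k hk => ?_) 2
    refine (Finset.abs_sum_le_sum_abs _ _).trans ?_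
    refine (Finset.sum_le_sum_of_subset_of_nonneg (t := Finset.Ioc 0 n) ?_
      fun _ _ _ => abs_nonneg _).trans (Finset.sum_le_sum fun i _ => ?_)
    · rw [zero_add]
      exact Finset.Ioc_subset_Ioc_right hk.2
    · exact (abs_sub _ _).trans (add_le_add (htle _) le_rfl)
  have hmarkov : μ {ω | (ε * a / 2) ^ 2 ≤ W ω ^ 2} ≤
      ENNReal.ofReal (C / (ε * a / 2) ^ 2) *
        (n * ∫⁻ x in Set.Ioc 0 a, g x * ENNReal.ofReal (2 * x)) := by
    have h1 := mul_meas_ge_le_integral_of_nonneg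
      (Eventually.of_forall fun ω => sq_nonneg (W ω)) hWint ((ε * a / 2) ^ 2)
    have h2 := hH a ha 0 n hn (by simp)
    have h3 : μ.real {ω | (ε * a / 2) ^ 2 ≤ W ω ^ 2} ≤ C / (ε * a / 2) ^ 2 *
        ∑ i ∈ Finset.Ioc 0 n, ∫ ω, (trunc a (Z i ω)) ^ 2 ∂μ := by
      rw [div_mul_eq_mul_div, le_div_iff₀ (by positivity), mul_comm]
      simpa using h1.trans h2
    have h4 := ENNReal.ofReal_le_ofReal h3
    rw [ofReal_measureReal, ENNReal.ofReal_mul (by positivity),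
      ENNReal.ofReal_sum_of_nonneg fun i _ => integral_nonneg fun ω => sq_nonneg _] at h4
    refine h4.trans (mul_le_mul_right ?_ _)
    have htsq : ∀ i ∈ Finset.Ioc 0 n, Integrable (fun ω => (trunc a (Z i ω)) ^ 2) μ := by
      intro i hi
      refine Integrable.of_bound ((htm i hi).pow_const 2).aestronglyMeasurable (a ^ 2)
        (Eventually.of_forall fun ω => ?_)
      rw [norm_pow, Real.norm_eq_abs]
      exact pow_le_pow_left₀ (abs_nonneg _) (htle _) 2
    calc ∑ i ∈ Finset.Ioc 0 n, ENNReal.ofReal (∫ ω, (trunc a (Z i ω)) ^ 2 ∂μ)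
        ≤ ∑ i ∈ Finset.Ioc 0 n, ∫⁻ t in Set.Ioc 0 a,
            μ {ω | t < |Z i ω|} * ENNReal.ofReal (2 * t) := Finset.sum_le_sum fun i hi => by
          rw [ofReal_integral_eq_lintegral_ofReal (htsq i hi)
            (Eventually.of_forall fun ω => sq_nonneg _)]
          exact lintegral_trunc_sq_le (hI i hi).1.1.aemeasurable ha
      _ = ∫⁻ t in Set.Ioc 0 a, ∑ i ∈ Finset.Ioc 0 n,
            μ {ω | t < |Z i ω|} * ENNReal.ofReal (2 * t) :=
          (lintegral_finsetSum _ fun i _ => (hanti i).measurable.mul (by fun_prop)).symm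
      _ ≤ ∫⁻ t in Set.Ioc 0 a, n * (g t * ENNReal.ofReal (2 * t)) :=
          lintegral_mono fun t => by
            rw [← Finset.sum_mul, ← mul_assoc]
            exact mul_le_mul_left (hg t) _
      _ = n * ∫⁻ t in Set.Ioc 0 a, g t * ENNReal.ofReal (2 * t) :=
          lintegral_const_mul _ (hgm.mul (by fun_prop))
  refine (measure_mono hsub).trans ((measure_union_le _ _).trans (add_le_add ?_ hmarkov))
  exact (measure_biUnion_finset_le _ _).trans (hg a)

end Probability

/-! ### Growth and summation estimates -/

/-- Potter's bound with exponent 1/2 gives `M y ≥ c y^(-1/2)`, hence `y M y ≥ c y^(1/2)`. -/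
theorem SlowlyVarying.tendsto_id_mul_atTop {M : ℝ → ℝ} (hM : SlowlyVarying M) :
    Tendsto (fun x => x * M x) atTop atTop := by
  obtain ⟨X, hX0, hX⟩ := hM.potter (η := 1 / 2) (by norm_num)
  have hMX := (hX X le_rfl).1
  have h1 : Tendsto (fun x : ℝ => x ^ (1 / 2 : ℝ)) atTop atTop := tendsto_rpow_atTop (by norm_num)
  refine tendsto_atTop_mono' _ ?_
    (h1.const_mul_atTop (r := M X / (2 / X) ^ (1 / 2 : ℝ)) (by positivity))
  filter_upwards [eventually_ge_atTop X] with y hy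
  have hy0 : 0 < y := hX0.trans_le hy
  have h2 := ((hX X le_rfl).2 y hy).2
  rw [show 2 * (y / X) = (2 / X) * y by ring, Real.mul_rpow (by positivity) hy0.le] at h2
  have h3 : y = y ^ (1 / 2 : ℝ) * y ^ (1 / 2 : ℝ) := by
    rw [← Real.rpow_add hy0]; norm_num
  rw [div_mul_eq_mul_div, div_le_iff₀ (by positivity)]
  calc M X * y ^ (1 / 2 : ℝ) ≤ ((2 / X) ^ (1 / 2 : ℝ) * y ^ (1 / 2 : ℝ) * M y) * y ^ (1 / 2 : ℝ) :=
        mul_le_mul_of_nonneg_right h2 (by positivity)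
    _ = (y ^ (1 / 2 : ℝ) * y ^ (1 / 2 : ℝ)) * M y * (2 / X) ^ (1 / 2 : ℝ) := by ring
    _ = y * M y * (2 / X) ^ (1 / 2 : ℝ) := by rw [← h3]

theorem tsum_ofReal_rpow_neg_le {r T : ℝ} (hr : 1 < r) (hT : 0 < T) :
    ∑' n : ℕ, (if 1 ≤ n ∧ T ≤ n then ENNReal.ofReal ((n : ℝ) ^ (-r)) else 0) ≤
      ENNReal.ofReal (2 ^ r / (r - 1) * T ^ (1 - r)) := by
  have hint : IntegrableOn (fun t : ℝ => 2 ^ r * t ^ (-r)) (Set.Ioi T) :=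
    (integrableOn_Ioi_rpow_of_lt (by linarith) hT).const_mul _
  have hval : ∫⁻ t in Set.Ioi T, ENNReal.ofReal (2 ^ r * t ^ (-r)) =
      ENNReal.ofReal (2 ^ r / (r - 1) * T ^ (1 - r)) := by
    rw [← ofReal_integral_eq_lintegral_ofReal hint, integral_const_mul,
      integral_Ioi_rpow_of_lt (by linarith) hT]
    · congr 1
      rw [show -r + 1 = -(r - 1) by ring, show 1 - r = -(r - 1) by ring]
      rw [neg_div_neg_eq]
      ring
    · filter_upwards [ae_restrict_mem measurableSet_Ioi] with t ht
      have : 0 < t := hT.trans ht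
      positivity
  rw [← hval]
  -- Integral comparison on disjoint unit intervals to the right of `T`: there `t ≤ n + 1 ≤ 2 n`,
  -- which is the source of `2 ^ r`.
  set s : ℕ → Set ℝ := fun n => if 1 ≤ n ∧ T ≤ n then Set.Ioc (n : ℝ) (n + 1) else ∅ with hs
  have hsm : ∀ n, MeasurableSet (s n) := by
    intro n
    simp only [hs]
    split_ifs
    · exact measurableSet_Ioc
    · exact MeasurableSet.empty
  have hdisj : Pairwise (Function.onFun Disjoint s) := by
    have h0 := Set.pairwise_disjoint_Ioc_intCast ℝ
    intro m n hmn
    have h1 : Disjoint (Set.Ioc (m : ℝ) (m + 1)) (Set.Ioc (n : ℝ) (n + 1)) := by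
      simpa [Function.onFun] using h0 (show (m : ℤ) ≠ n by exact_mod_cast hmn)
    simp only [Function.onFun, hs]
    split_ifs <;> simp [h1]
  have hsub : (⋃ n, s n) ⊆ Set.Ioi T := by
    refine Set.iUnion_subset fun n t ht => ?_
    simp only [hs] at ht
    split_ifs at ht with h
    · exact h.2.trans_lt ht.1
    · exact ht.elim
  refine le_trans ?_ (lintegral_mono_set hsub)
  rw [lintegral_iUnion hsm hdisj]
  refine ENNReal.tsum_le_tsum fun n => ?_
  simp only [hs]
  split_ifs with h
  · have hn1 : (1 : ℝ) ≤ n := by exact_mod_cast h.1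
    have : ∫⁻ _ in Set.Ioc (n : ℝ) (n + 1), ENNReal.ofReal ((n : ℝ) ^ (-r)) =
        ENNReal.ofReal ((n : ℝ) ^ (-r)) := by simp
    rw [← this]
    refine setLIntegral_mono' measurableSet_Ioc fun t ht => ENNReal.ofReal_le_ofReal ?_
    have ht0 : 0 < t := by linarith [ht.1]
    rw [Real.rpow_neg (by positivity), Real.rpow_neg ht0.le, ← div_eq_mul_inv,
      ← Real.inv_rpow (by positivity), ← Real.div_rpow (by norm_num) ht0.le]
    refine Real.rpow_le_rpow (by positivity) ?_ (by linarith)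
    rw [inv_le_iff_one_le_mul₀ (by positivity), div_mul_eq_mul_div, le_div_iff₀ ht0]
    linarith [ht.2]
  · simp

/-- The weight `x ^ (p - 1) * L x ^ p` is almost increasing. -/
theorem SlowlyVarying.rpow_mul_rpow_le {L : ℝ → ℝ} (hL : SlowlyVarying L) {p : ℝ} (hp : 1 ≤ p)
    (hL1 : p = 1 → MonotoneOn L (Set.Ici 0)) :
    ∃ X : ℝ, 0 < X ∧ ∀ b, X ≤ b → 0 < L b ∧ ∀ x, b ≤ x →
      b ^ (p - 1) * L b ^ p ≤ 2 ^ (p - 1) * (x ^ (p - 1) * L x ^ p) := by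
  rcases hp.eq_or_lt with rfl | hp1
  -- For `p = 1` the factor `x^(p-1)` has no growth to offset Potter's loss; monotonicity of `L`
  -- replaces it.
  · obtain ⟨X, hX⟩ := eventually_atTop.1 hL.eventually_pos
    refine ⟨max X 1, by positivity, fun b hb => ⟨hX b ((le_max_left _ _).trans hb),
      fun x hx => ?_⟩⟩
    have hb0 : 0 ≤ b := zero_le_one.trans ((le_max_right _ _).trans hb)
    simpa using hL1 rfl hb0 (hb0.trans hx) hx
  · have hp0 : 0 < p := by linarith
    obtain ⟨X, hX0, hX⟩ := hL.potter (η := (p - 1) / p) (div_pos (by linarith) hp0)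
    refine ⟨X, hX0, fun b hb => ⟨(hX b hb).1, fun x hx => ?_⟩⟩
    have hb0 : 0 < b := hX0.trans_le hb
    have hx0 : 0 < x := hb0.trans_le hx
    have hLb := (hX b hb).1
    have hLx := (hX x (hb.trans hx)).1
    have h1 := Real.rpow_le_rpow hLb.le ((hX b hb).2 x hx).2 hp0.le
    rw [Real.mul_rpow (by positivity) hLx.le, ← Real.rpow_mul (by positivity),
      div_mul_cancel₀ _ hp0.ne', Real.mul_rpow (by norm_num) (by positivity),
      Real.div_rpow hx0.le hb0.le] at h1
    calc b ^ (p - 1) * L b ^ p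
        ≤ b ^ (p - 1) * (2 ^ (p - 1) * (x ^ (p - 1) / b ^ (p - 1)) * L x ^ p) := by gcongr
      _ = 2 ^ (p - 1) * (x ^ (p - 1) * L x ^ p) := by
        have : b ^ (p - 1) ≠ 0 := by positivity
        field_simp

/-- If `b n * L (b n)` is comparable to `n ^ (1 / p)`, then the sum of `(b n)⁻¹ ^ 2` over
`b n ≥ x` is at most of order `x ^ (p - 2) * L x ^ p`. -/
theorem SlowlyVarying.tsum_inv_sq_le {L : ℝ → ℝ} (hL : SlowlyVarying L) {p : ℝ} (hp1 : 1 ≤ p)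
    (hp2 : p < 2) :
    ∃ X D : ℝ, 0 < X ∧ 0 < D ∧ (∀ x, X ≤ x → 0 < L x) ∧
      ∀ (b : ℕ → ℝ) (S : Set ℕ) [DecidablePred (· ∈ S)],
      (∀ n ∈ S, 1 ≤ n ∧ X ≤ b n ∧ (n : ℝ) ^ (1 / p) ≤ 2 * (b n * L (b n)) ∧
        b n * L (b n) ≤ 2 * (n : ℝ) ^ (1 / p)) →
      ∀ x, X ≤ x → (∑' n : ℕ, if n ∈ S ∧ x ≤ b n then ENNReal.ofReal ((b n ^ 2)⁻¹) else 0) ≤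
        ENNReal.ofReal (D * (x ^ (p - 2) * L x ^ p)) := by
  have hp0 : 0 < p := by linarith
  -- `r` is the midpoint of 1 and `2 / p`, and `η` solves `(1 + η) p r = 2`. Raising Potter's bound
  -- on `n^(1/p)` to the power `p r` thus gives exactly `(b n)²`, while `∑ n^(-r)` converges.
  set r : ℝ := (p + 2) / (2 * p) with hr
  have hr1 : 1 < r := by rw [hr, lt_div_iff₀ (by positivity)]; linarith
  set η : ℝ := (2 - p) / (p + 2) with hη
  have hη0 : 0 < η := div_pos (by linarith) (by linarith)
  have hη1 : η ≤ 1 := by rw [hη, div_le_one (by linarith)]; linarith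
  have hpr : (1 + η) * (p * r) = 2 := by rw [hη, hr]; field_simp; ring
  obtain ⟨X, hX0, hX⟩ := hL.potter hη0
  refine ⟨X, 4 * 2 ^ (p * r) * (2 ^ r / (r - 1)) * 4 ^ (p * r - p), hX0, ?_,
    fun x hx => (hX x hx).1, ?_⟩
  · have : 0 < r - 1 := by linarith
    positivity
  intro b S _ hb x hx
  have hx0 : 0 < x := hX0.trans_le hx
  have hLx := (hX x hx).1
  set ψ : ℝ := x * L x with hψ
  have hψ0 : 0 < ψ := by positivity
  have hterm : ∀ n : ℕ, (if n ∈ S ∧ x ≤ b n then ENNReal.ofReal ((b n ^ 2)⁻¹) else 0) ≤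
      ENNReal.ofReal (4 * (x ^ 2)⁻¹ * (2 * ψ) ^ (p * r)) *
        (if 1 ≤ n ∧ (ψ / 4) ^ p ≤ n then ENNReal.ofReal ((n : ℝ) ^ (-r)) else 0) := by
    intro n
    by_cases hn : n ∈ S ∧ x ≤ b n
    · obtain ⟨hnS, hxb⟩ := hn
      obtain ⟨hn1, hbX, hlo, hup⟩ := hb n hnS
      have hb0 : 0 < b n := hx0.trans_le hxb
      have hn0 : (0 : ℝ) < n := by exact_mod_cast hn1
      have hLb := (hX _ hbX).1
      have hq : 1 ≤ b n / x := (one_le_div hx0).2 hxb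
      have hq0 : 0 < b n / x := by positivity
      obtain ⟨hP1, hP2⟩ := (hX x hx).2 (b n) hxb
      -- The condition `x ≤ b n` forces `n` to be large, since `y L(y)` is almost increasing; no
      -- monotonicity of `b` is needed.
      have hT : (ψ / 4) ^ p ≤ n := by
        have h1 : ψ ≤ 4 * (n : ℝ) ^ (1 / p) := by
          have h2 : (2 * (b n / x)) ^ η ≤ 2 * (b n / x) := by
            conv_rhs => rw [← Real.rpow_one (2 * (b n / x))]
            exact Real.rpow_le_rpow_of_exponent_le (by linarith) hη1
          calc ψ ≤ x * (2 * (b n / x) * L (b n)) := by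
                rw [hψ]
                exact mul_le_mul_of_nonneg_left
                  (hP2.trans (mul_le_mul_of_nonneg_right h2 hLb.le)) hx0.le
            _ = 2 * (b n * L (b n)) := by field_simp
            _ ≤ 4 * (n : ℝ) ^ (1 / p) := by linarith
        calc (ψ / 4) ^ p ≤ ((n : ℝ) ^ (1 / p)) ^ p :=
              Real.rpow_le_rpow (by positivity) (by linarith) hp0.le
          _ = n := by rw [← Real.rpow_mul hn0.le, one_div_mul_cancel hp0.ne', Real.rpow_one]
      rw [if_pos ⟨hnS, hxb⟩, if_pos ⟨hn1, hT⟩, ← ENNReal.ofReal_mul (by positivity)]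
      refine ENNReal.ofReal_le_ofReal ?_
      have h3 : (n : ℝ) ^ (1 / p) ≤ 2 * ψ * (2 * (b n / x)) ^ (1 + η) := by
        rw [Real.rpow_add (by positivity), Real.rpow_one]
        calc (n : ℝ) ^ (1 / p) ≤ 2 * (b n * ((2 * (b n / x)) ^ η * L x)) := by
              refine hlo.trans ?_
              gcongr
          _ = ψ * (2 * (b n / x)) * (2 * (b n / x)) ^ η := by rw [hψ]; field_simp
          _ ≤ 2 * (ψ * (2 * (b n / x)) * (2 * (b n / x)) ^ η) := by
              have : 0 ≤ ψ * (2 * (b n / x)) * (2 * (b n / x)) ^ η := by positivity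
              linarith
          _ = _ := by ring
      have h4 := Real.rpow_le_rpow (by positivity) h3 (show 0 ≤ p * r by positivity)
      rw [← Real.rpow_mul hn0.le, Real.mul_rpow (by positivity) (by positivity),
        ← Real.rpow_mul (by positivity), hpr, Real.rpow_two,
        show 1 / p * (p * r) = r by field_simp] at h4
      rw [Real.rpow_neg hn0.le, ← div_eq_mul_inv, le_div_iff₀ (by positivity),
        inv_mul_le_iff₀ (by positivity)]
      refine h4.trans (le_of_eq ?_)
      field_simp
      ring
    · rw [if_neg hn]
      exact zero_le
  refine (ENNReal.tsum_le_tsum hterm).trans ?_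
  rw [ENNReal.tsum_mul_left]
  refine (mul_le_mul_right (tsum_ofReal_rpow_neg_le hr1 (by positivity)) _).trans ?_
  rw [← ENNReal.ofReal_mul (by positivity)]
  refine ENNReal.ofReal_le_ofReal (le_of_eq ?_)
  rw [← Real.rpow_mul (by positivity), Real.mul_rpow (by norm_num) hψ0.le,
    Real.div_rpow hψ0.le (by norm_num), show p * (1 - r) = p - p * r by ring,
    Real.rpow_sub hψ0, show p - p * r = - (p * r - p) by ring, Real.rpow_neg (by norm_num),
    hψ, Real.mul_rpow hx0.le hLx.le, Real.mul_rpow hx0.le hLx.le, Real.rpow_sub hx0, Real.rpow_two]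
  field_simp

/-! ### The averaged tail -/

section AveragedTail

variable {Ω : Type*} [MeasurableSpace Ω] {μ : Measure Ω} [IsProbabilityMeasure μ]
  (X : ℕ → ℕ → Ω → ℝ)

theorem inv_mul_sum_measureReal_le_one (n : ℕ+) (x : ℝ) :
    ((n : ℕ) : ℝ)⁻¹ * ∑ i ∈ Finset.Icc 1 (n : ℕ), μ.real {ω | x < |X n i ω|} ≤ 1 := by
  have hn : (0 : ℝ) < (n : ℕ) := by exact_mod_cast n.pos
  rw [inv_mul_le_iff₀ hn, mul_one]
  refine (Finset.sum_le_card_nsmul _ _ 1 fun i _ => measureReal_le_one).trans ?_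
  simp

theorem bddAbove_averagedTail (x : ℝ) :
    BddAbove (Set.range fun n : ℕ+ =>
      ((n : ℕ) : ℝ)⁻¹ * ∑ i ∈ Finset.Icc 1 (n : ℕ), μ.real {ω | x < |X n i ω|}) :=
  ⟨1, by rintro _ ⟨n, rfl⟩; exact inv_mul_sum_measureReal_le_one X n x⟩

theorem averagedTail_le_one (x : ℝ) : averagedTail μ X x ≤ 1 :=
  ciSup_le fun n => inv_mul_sum_measureReal_le_one X n x

theorem antitone_averagedTail : Antitone (averagedTail μ X) := by
  intro x y hxy
  refine ciSup_mono (bddAbove_averagedTail X x) fun n => ?_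
  refine mul_le_mul_of_nonneg_left (Finset.sum_le_sum fun i _ => ?_) (by positivity)
  exact measureReal_mono fun ω (hω : y < _) => lt_of_le_of_lt hxy hω

theorem sum_measure_le_averagedTail {n : ℕ} (hn : 1 ≤ n) (x : ℝ) :
    ∑ i ∈ Finset.Ioc 0 n, μ {ω | x < |X n i ω|} ≤ n * ENNReal.ofReal (averagedTail μ X x) := by
  have h := le_ciSup (bddAbove_averagedTail (μ := μ) X x) ⟨n, hn⟩
  have hn0 : (0 : ℝ) < n := by exact_mod_cast hn
  simp only [PNat.mk_coe] at h
  rw [inv_mul_le_iff₀ hn0] at h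
  have h2 := ENNReal.ofReal_le_ofReal h
  rw [ENNReal.ofReal_mul hn0.le, ENNReal.ofReal_natCast,
    ENNReal.ofReal_sum_of_nonneg fun i _ => measureReal_nonneg] at h2
  refine le_trans (le_of_eq (Finset.sum_congr rfl fun i _ => ?_)) h2
  rw [ofReal_measureReal]

end AveragedTail

/-! ### Integral estimates and the de Bruijn normalisation -/

/-- Interchange of a series over `n` with integrals over `(0, b n]`. -/
theorem tsum_mul_setLIntegral_lt_top {g F T : ℝ → ENNReal} (hgm : Measurable g)
    (hg1 : ∀ x, g x ≤ 1) {X : ℝ} (hX : 0 < X) {c : ENNReal} (hc : c ≠ ⊤)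
    (hF : ∫⁻ x in Set.Ioi 0, F x < ⊤) (hTX : T X ≠ ⊤)
    (hT : ∀ x, X ≤ x → T x * (g x * ENNReal.ofReal (2 * x)) ≤ c * F x)
    {b : ℕ → ℝ} {S : Set ℕ} [DecidablePred (· ∈ S)] {a : ℕ → ENNReal}
    (hbX : ∀ n ∈ S, X ≤ b n)
    (hS : ∀ x, X ≤ x → (∑' n : ℕ, if n ∈ S ∧ x ≤ b n then a n else 0) ≤ T x) :
    ∑' n, (if n ∈ S then
      a n * ∫⁻ x in Set.Ioc 0 (b n), g x * ENNReal.ofReal (2 * x) else 0) < ⊤ := by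
  set h : ℝ → ENNReal := fun x => g x * ENNReal.ofReal (2 * x) with hh
  have hhm : Measurable h := hgm.mul (by fun_prop)
  have hterm : ∀ n, (if n ∈ S then a n * ∫⁻ x in Set.Ioc 0 (b n), h x else 0) =
      ∫⁻ x in Set.Ioi 0, (if n ∈ S ∧ x ≤ b n then a n else 0) * h x := by
    intro n
    by_cases hn : n ∈ S
    · rw [if_pos hn, ← lintegral_const_mul _ hhm, ← lintegral_indicator measurableSet_Ioc,
        ← lintegral_indicator measurableSet_Ioi]
      refine lintegral_congr fun x => ?_
      by_cases h0 : 0 < x <;> by_cases hb : x ≤ b n <;> simp [Set.indicator, hn, h0, hb]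
    · simp [hn]
  have hmeas : ∀ n, Measurable fun x : ℝ => (if n ∈ S ∧ x ≤ b n then a n else 0) * h x := by
    intro n
    refine Measurable.mul (Measurable.ite ?_ measurable_const measurable_const) hhm
    by_cases hn : n ∈ S
    · have : {x : ℝ | n ∈ S ∧ x ≤ b n} = Set.Iic (b n) := by ext; simp [hn]
      rw [this]
      exact measurableSet_Iic
    · simp [hn]
  rw [tsum_congr hterm, ← lintegral_tsum fun n => (hmeas n).aemeasurable]
  simp_rw [ENNReal.tsum_mul_right]
  rw [← Set.Ioc_union_Ioi_eq_Ioi hX.le]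
  -- On `(0, X]` the inner sum is at most its value at `X`, because every `b n ≥ X`; beyond `X` the
  -- bound by `c * F` applies.
  refine (lintegral_union_le _ _ _).trans_lt (ENNReal.add_lt_top.2 ⟨?_, ?_⟩)
  · refine (setLIntegral_mono' (g := fun _ => T X * ENNReal.ofReal (2 * X)) measurableSet_Ioc
      fun x hx => ?_).trans_lt ?_
    · refine mul_le_mul' ?_ ?_
      · refine le_trans (ENNReal.tsum_le_tsum fun n => ?_) (hS X le_rfl)
        by_cases hn : n ∈ S
        · rw [if_pos (⟨hn, hbX n hn⟩ : n ∈ S ∧ X ≤ b n)]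
          split_ifs <;> simp
        · simp [hn]
      · refine (mul_le_mul' (hg1 x) le_rfl).trans ?_
        rw [one_mul]
        exact ENNReal.ofReal_le_ofReal (by linarith [hx.2])
    · rw [setLIntegral_const, Real.volume_Ioc]
      exact ENNReal.mul_lt_top (ENNReal.mul_lt_top hTX.lt_top ENNReal.ofReal_lt_top)
        ENNReal.ofReal_lt_top
  · calc ∫⁻ x in Set.Ioi X, (∑' n, if n ∈ S ∧ x ≤ b n then a n else 0) * h x
        ≤ ∫⁻ x in Set.Ioi X, c * F x := setLIntegral_mono' measurableSet_Ioi fun x hx =>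
          (mul_le_mul' (hS x (le_of_lt hx)) le_rfl).trans (hT x (le_of_lt hx))
      _ ≤ c * ∫⁻ x in Set.Ioi 0, F x := by
          rw [lintegral_const_mul' _ _ hc]
          exact mul_le_mul' le_rfl (lintegral_mono_set (Set.Ioi_subset_Ioi hX.le))
      _ < ⊤ := ENNReal.mul_lt_top hc.lt_top hF

/-- Continuity from above of the finite measure with density `F`; `F` need not be measurable, which
matters because `L` is arbitrary near 0. -/
theorem tendsto_setLIntegral_Ioi_atTop {F : ℝ → ENNReal} (hF : ∫⁻ x in Set.Ioi 0, F x < ⊤) :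
    Tendsto (fun b => ∫⁻ x in Set.Ioi b, F x) atTop (𝓝 0) := by
  set ν : Measure ℝ := (volume.restrict (Set.Ioi 0)).withDensity F with hν
  have : IsFiniteMeasure ν := isFiniteMeasure_withDensity hF.ne
  have h := tendsto_measure_iInter_atTop (μ := ν) (s := fun b : ℝ => Set.Ioi b)
    (fun b => measurableSet_Ioi.nullMeasurableSet) (fun x y hxy => Set.Ioi_subset_Ioi hxy)
    ⟨0, measure_ne_top _ _⟩
  have he : ⋂ b : ℝ, Set.Ioi b = ∅ := by
    ext x
    simp only [Set.mem_iInter, Set.mem_Ioi, Set.mem_empty_iff_false, iff_false, not_forall, not_lt]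
    exact ⟨x, le_rfl⟩
  rw [he, measure_empty] at h
  refine h.congr' ?_
  filter_upwards [eventually_ge_atTop 0] with b hb
  rw [hν, Function.comp_apply, withDensity_apply _ measurableSet_Ioi,
    Measure.restrict_restrict measurableSet_Ioi,
    Set.inter_eq_left.2 (Set.Ioi_subset_Ioi hb)]

/-- `a² = ∫_0^a 2x dx`, and `g ≥ g a` on that range. -/
theorem mul_le_setLIntegral_of_antitone {g : ℝ → ENNReal} (hg : Antitone g) {a : ℝ} (ha : 0 < a) :
    ENNReal.ofReal (a ^ 2) * g a ≤ ∫⁻ x in Set.Ioc 0 a, g x * ENNReal.ofReal (2 * x) := by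
  have h1 : ENNReal.ofReal (a ^ 2) = ∫⁻ x in Set.Ioc 0 a, ENNReal.ofReal (2 * x) := by
    rw [← ofReal_integral_eq_lintegral_ofReal, ← intervalIntegral.integral_of_le ha.le]
    · congr 1
      rw [intervalIntegral.integral_const_mul, integral_id]
      ring
    · exact (continuous_const.mul continuous_id).integrableOn_Icc.mono_set Set.Ioc_subset_Icc_self
    · filter_upwards [ae_restrict_mem measurableSet_Ioc] with x hx
      have := hx.1
      positivity
  rw [h1, mul_comm, ← lintegral_const_mul _ (by fun_prop)]
  exact setLIntegral_mono' measurableSet_Ioc fun x hx => mul_le_mul' (hg hx.2) le_rfl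

theorem IsDeBruijnConjugate.tendsto_rpow_mul_atTop {L M : ℝ → ℝ} (hM : IsDeBruijnConjugate L M)
    {p : ℝ} (hp : 0 < p) :
    Tendsto (fun n : ℕ => (n : ℝ) ^ (1 / p) * M ((n : ℝ) ^ (1 / p))) atTop atTop :=
  hM.slowlyVarying.tendsto_id_mul_atTop.comp
    ((tendsto_rpow_atTop (by positivity)).comp tendsto_natCast_atTop_atTop)

theorem IsDeBruijnConjugate.eventually_comparable {L M : ℝ → ℝ} (hM : IsDeBruijnConjugate L M) :
    ∀ᶠ s in atTop, s ≤ 2 * (s * M s * L (s * M s)) ∧ s * M s * L (s * M s) ≤ 2 * s := by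
  filter_upwards [hM.right.eventually_const_lt (u := 1 / 2) (by norm_num),
    hM.right.eventually_lt_const (u := 2) (by norm_num), eventually_gt_atTop 0] with s h1 h2 h0
  rw [mul_assoc]
  constructor <;> nlinarith

/-- Along `b → ∞` with `n` comparable to `(b * L b) ^ p`, the mean correction is negligible. -/
theorem natCast_mul_setLIntegral_Ioi_le {L : ℝ → ℝ} {p : ℝ} (hp : 1 ≤ p) {n : ℕ} {b ε : ℝ}
    (hb : 0 < b) (hLb : 0 < L b) {g F : ℝ → ENNReal}
    (hn : (n : ℝ) ^ (1 / p) ≤ 2 * (b * L b))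
    (hw : ∀ x, b ≤ x → ENNReal.ofReal (b ^ (p - 1) * L b ^ p) * g x ≤
      ENNReal.ofReal (2 ^ (p - 1)) * F x)
    (hF : ∫⁻ x in Set.Ioi b, F x ≤ ENNReal.ofReal (ε / (2 * (2 ^ p * 2 ^ (p - 1))))) :
    n * ∫⁻ x in Set.Ioi b, g x ≤ ENNReal.ofReal (ε * b / 2) := by
  have hp0 : 0 < p := by linarith
  have hn2 : (n : ℝ) ≤ 2 ^ p * b * (b ^ (p - 1) * L b ^ p) := by
    calc (n : ℝ) = ((n : ℝ) ^ (1 / p)) ^ p := by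
          rw [← Real.rpow_mul n.cast_nonneg, one_div_mul_cancel hp0.ne', Real.rpow_one]
      _ ≤ (2 * (b * L b)) ^ p := Real.rpow_le_rpow (by positivity) hn hp0.le
      _ = 2 ^ p * b * (b ^ (p - 1) * L b ^ p) := by
          rw [Real.mul_rpow (by norm_num) (by positivity), Real.mul_rpow hb.le hLb.le,
            Real.rpow_sub_one hb.ne']
          field_simp
  have hint : ENNReal.ofReal (b ^ (p - 1) * L b ^ p) * ∫⁻ x in Set.Ioi b, g x ≤
      ENNReal.ofReal (2 ^ (p - 1)) * ∫⁻ x in Set.Ioi b, F x := by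
    rw [← lintegral_const_mul' _ _ ENNReal.ofReal_ne_top,
      ← lintegral_const_mul' _ _ ENNReal.ofReal_ne_top]
    exact setLIntegral_mono' measurableSet_Ioi fun x hx => hw x (le_of_lt hx)
  calc (n : ENNReal) * ∫⁻ x in Set.Ioi b, g x
      ≤ ENNReal.ofReal (2 ^ p * b * (b ^ (p - 1) * L b ^ p)) * ∫⁻ x in Set.Ioi b, g x := by
        rw [← ENNReal.ofReal_natCast]
        exact mul_le_mul' (ENNReal.ofReal_le_ofReal hn2) le_rfl
    _ = ENNReal.ofReal (2 ^ p * b) *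
          (ENNReal.ofReal (b ^ (p - 1) * L b ^ p) * ∫⁻ x in Set.Ioi b, g x) := by
        rw [ENNReal.ofReal_mul (by positivity), mul_assoc]
    _ ≤ ENNReal.ofReal (2 ^ p * b) * (ENNReal.ofReal (2 ^ (p - 1)) *
          ENNReal.ofReal (ε / (2 * (2 ^ p * 2 ^ (p - 1))))) :=
        mul_le_mul' le_rfl (hint.trans (mul_le_mul' le_rfl hF))
    _ = ENNReal.ofReal (ε * b / 2) := by
        rw [← ENNReal.ofReal_mul (by positivity), ← ENNReal.ofReal_mul (by positivity)]
        congr 1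
        field_simp

/-! ### The main theorem -/

theorem theorem4p1 {Ω : Type*} [MeasurableSpace Ω] (μ : Measure Ω) [IsProbabilityMeasure μ]
    (X : ℕ → ℕ → Ω → ℝ)
    (hint : ∀ n i : ℕ, 1 ≤ i → i ≤ n → Integrable (X n i) μ)
    (hmean : ∀ n i : ℕ, 1 ≤ i → i ≤ n → ∫ ω, X n i ω ∂μ = 0)
    (hH : ∃ C : ℝ, ∀ n : ℕ, 1 ≤ n → ConditionH μ (X n) n C)
    (p : ℝ) (hp1 : 1 ≤ p) (hp2 : p < 2)
    (L M : ℝ → ℝ) (hL : SlowlyVarying L)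
    (hL1 : p = 1 → MonotoneOn L (Set.Ici 0) ∧ ∀ x : ℝ, 0 ≤ x → 1 ≤ L x)
    (hM : IsDeBruijnConjugate L M)
    (hG : ∫⁻ x in Set.Ioi (0 : ℝ),
      ENNReal.ofReal (x ^ (p - 1) * (L x) ^ p * averagedTail μ X x) < ⊤) :
    ∀ ε : ℝ, 0 < ε →
      Summable (fun n : ℕ => (n : ℝ)⁻¹ *
        μ.real {ω | ε * ((n : ℝ) ^ (1 / p) * M ((n : ℝ) ^ (1 / p))) <
          maxPartialSum (fun i => X n i ω) 0 n}) := by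
  intro ε hε
  classical
  have hp0 : 0 < p := by linarith
  obtain ⟨C₀, hC₀⟩ := hH
  -- The given constant may be negative; enlarging it preserves (H).
  set C := max C₀ 0 with hC
  have hC0 : 0 ≤ C := le_max_right _ _
  have hHC : ∀ n : ℕ, 1 ≤ n → ConditionH μ (X n) n C := fun n hn a ha m k hk hmk =>
    (hC₀ n hn a ha m k hk hmk).trans (mul_le_mul_of_nonneg_right (le_max_left _ _)
      (Finset.sum_nonneg fun i _ => integral_nonneg fun ω => sq_nonneg _))
  set G := averagedTail μ X with hGdef
  set g : ℝ → ENNReal := fun x => ENNReal.ofReal (G x) with hg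
  have hganti : Antitone g := fun x y hxy =>
    ENNReal.ofReal_le_ofReal (antitone_averagedTail X hxy)
  have hg1 : ∀ x, g x ≤ 1 := fun x => ENNReal.ofReal_le_one.2 (averagedTail_le_one X x)
  set F : ℝ → ENNReal := fun x => ENNReal.ofReal (x ^ (p - 1) * L x ^ p * G x) with hF
  obtain ⟨X₁, hX₁, hw⟩ := hL.rpow_mul_rpow_le hp1 fun h => (hL1 h).1
  obtain ⟨X₂, D, hX₂, hD, hLX₂, htsum⟩ := hL.tsum_inv_sq_le hp1 hp2
  set b : ℕ → ℝ := fun n => (n : ℝ) ^ (1 / p) * M ((n : ℝ) ^ (1 / p)) with hb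
  have hbtop : Tendsto b atTop atTop := hM.tendsto_rpow_mul_atTop hp0
  -- The indices at which all asymptotic estimates hold; only finitely many are missing, so
  -- summability may be tested on `S`.
  set S : Set ℕ := {n | 1 ≤ n ∧ X₁ ≤ b n ∧ X₂ ≤ b n ∧ (n : ℝ) ^ (1 / p) ≤ 2 * (b n * L (b n)) ∧
    b n * L (b n) ≤ 2 * (n : ℝ) ^ (1 / p) ∧
    n * ∫⁻ x in Set.Ioi (b n), g x ≤ ENNReal.ofReal (ε * b n / 2)} with hS
  have hSev : ∀ᶠ n in atTop, n ∈ S := by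
    have hcomp := ((tendsto_rpow_atTop (y := 1 / p) (by positivity)).comp
      tendsto_natCast_atTop_atTop).eventually hM.eventually_comparable
    have hFs := ((tendsto_setLIntegral_Ioi_atTop hG).comp hbtop).eventually_le_const
      (u := ENNReal.ofReal (ε / (2 * (2 ^ p * 2 ^ (p - 1))))) (by
        rw [ENNReal.ofReal_pos]; positivity)
    filter_upwards [eventually_ge_atTop 1, hbtop.eventually_ge_atTop X₁,
      hbtop.eventually_ge_atTop X₂, hcomp, hFs] with n h1 h2 h3 h4 h5
    refine ⟨h1, h2, h3, h4.1, h4.2, ?_⟩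
    refine natCast_mul_setLIntegral_Ioi_le hp1 (hX₁.trans_le h2) (hw _ h2).1 h4.1
      (fun x hx => ?_) h5
    have hx0 : 0 < x := (hX₁.trans_le h2).trans_le hx
    have hLx := (hw x (h2.trans hx)).1
    calc ENNReal.ofReal (b n ^ (p - 1) * L (b n) ^ p) * g x
        ≤ ENNReal.ofReal (2 ^ (p - 1) * (x ^ (p - 1) * L x ^ p)) * g x :=
          mul_le_mul' (ENNReal.ofReal_le_ofReal ((hw _ h2).2 x hx)) le_rfl
      _ = ENNReal.ofReal (2 ^ (p - 1)) * F x := by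
          rw [ENNReal.ofReal_mul (by positivity), mul_assoc,
            ← ENNReal.ofReal_mul (by positivity)]
  set f : ℕ → ℝ := fun n => (n : ℝ)⁻¹ *
    μ.real {ω | ε * b n < maxPartialSum (fun i => X n i ω) 0 n} with hf
  have hf0 : ∀ n, 0 ≤ f n := fun n => by positivity
  set J : ℕ → ENNReal := fun n => ∫⁻ x in Set.Ioc 0 (b n), g x * ENNReal.ofReal (2 * x) with hJ
  -- The 1 accounts for the term `n * g (b n)`, the rest for Chebyshev's inequality at level `ε * b
  -- n / 2`.
  set K : ENNReal := 1 + ENNReal.ofReal (4 * C / ε ^ 2) with hK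
  have hbound : ∀ n ∈ S, ENNReal.ofReal (f n) ≤ K * (ENNReal.ofReal ((b n ^ 2)⁻¹) * J n) := by
    rintro n ⟨h1, h2, -, -, -, h6⟩
    have hb0 : 0 < b n := hX₁.trans_le h2
    have hn0 : (0 : ℝ) < n := by exact_mod_cast h1
    have h7 := (hHC n h1).measure_lt_maxPartialSum_le h1 hC0 (hint n) (hmean n)
      (sum_measure_le_averagedTail X h1) hganti.measurable hb0 hε h6
    have h8 : g (b n) ≤ ENNReal.ofReal ((b n ^ 2)⁻¹) * J n := by
      refine le_trans ?_ (mul_le_mul' le_rfl (mul_le_setLIntegral_of_antitone hganti hb0))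
      rw [← mul_assoc, ← ENNReal.ofReal_mul (by positivity), inv_mul_cancel₀ (by positivity)]
      simp
    have h9 : ENNReal.ofReal (C / (ε * b n / 2) ^ 2) =
        ENNReal.ofReal (4 * C / ε ^ 2) * ENNReal.ofReal ((b n ^ 2)⁻¹) := by
      rw [← ENNReal.ofReal_mul (by positivity)]
      congr 1
      field_simp
      ring
    have h10 : ENNReal.ofReal ((n : ℝ)⁻¹) * n = 1 := by
      rw [← ENNReal.ofReal_natCast, ← ENNReal.ofReal_mul (by positivity),
        inv_mul_cancel₀ hn0.ne', ENNReal.ofReal_one]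
    calc ENNReal.ofReal (f n)
        = ENNReal.ofReal ((n : ℝ)⁻¹) *
            μ {ω | ε * b n < maxPartialSum (fun i => X n i ω) 0 n} := by
          rw [hf, ENNReal.ofReal_mul (by positivity), ofReal_measureReal]
      _ ≤ ENNReal.ofReal ((n : ℝ)⁻¹) *
            (n * g (b n) + ENNReal.ofReal (C / (ε * b n / 2) ^ 2) * (n * J n)) :=
          mul_le_mul' le_rfl h7
      _ = (ENNReal.ofReal ((n : ℝ)⁻¹) * n) *
            (g (b n) + ENNReal.ofReal (C / (ε * b n / 2) ^ 2) * J n) := by ring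
      _ = g (b n) + ENNReal.ofReal (4 * C / ε ^ 2) * (ENNReal.ofReal ((b n ^ 2)⁻¹) * J n) := by
          rw [h10, h9, one_mul, mul_assoc]
      _ ≤ K * (ENNReal.ofReal ((b n ^ 2)⁻¹) * J n) := by
          rw [hK, add_mul, one_mul]
          exact add_le_add h8 le_rfl
  have hseries : ∑' n, (if n ∈ S then ENNReal.ofReal ((b n ^ 2)⁻¹) * J n else 0) < ⊤ := by
    refine tsum_mul_setLIntegral_lt_top (F := F) (X := X₂) (c := ENNReal.ofReal (2 * D))
      (T := fun x => ENNReal.ofReal (D * (x ^ (p - 2) * L x ^ p)))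
      hganti.measurable hg1 hX₂ ENNReal.ofReal_ne_top hG ENNReal.ofReal_ne_top ?_
      (fun n hn => hn.2.2.1)
      (htsum b S fun n hn => ⟨hn.1, hn.2.2.1, hn.2.2.2.1, hn.2.2.2.2.1⟩)
    intro x hx
    have hx0 : 0 < x := hX₂.trans_le hx
    have hLx := hLX₂ x hx
    rw [hF, hg, mul_left_comm, ← ENNReal.ofReal_mul (by positivity), mul_comm,
      ← ENNReal.ofReal_mul (by positivity), ← ENNReal.ofReal_mul (by positivity)]
    refine ENNReal.ofReal_le_ofReal (le_of_eq ?_)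
    rw [show p - 1 = (p - 2) + 1 by ring, Real.rpow_add_one hx0.ne']
    ring
  have hsum : ∑' n, ENNReal.ofReal (if n ∈ S then f n else 0) ≠ ⊤ := by
    refine ne_top_of_le_ne_top (ENNReal.mul_lt_top (show K < ⊤ by rw [hK]; finiteness)
      hseries).ne ?_
    rw [← ENNReal.tsum_mul_left]
    refine ENNReal.tsum_le_tsum fun n => ?_
    by_cases hn : n ∈ S
    · simpa only [if_pos hn] using hbound n hn
    · simp [hn]
  have hsummable : Summable fun n => if n ∈ S then f n else 0 := by
    refine (ENNReal.summable_toReal hsum).congr fun n => ENNReal.toReal_ofReal ?_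
    split_ifs
    · exact hf0 n
    · exact le_rfl
  refine hsummable.congr_cofinite ?_
  rw [Nat.cofinite_eq_atTop]
  filter_upwards [hSev] with n hn
  rw [if_pos hn]
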